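/- For positive integers $i_1,\dots,i_k$ with $i_1>1$ let $$\zeta(i_1,\dots,i_k)=\sum_{n_1>\dots>n_k\ge 1}\frac{1}{n_1^{i_1}\cdots n_k^{i_k}}$$ be the multiple zeta value of weight $i_1+\dots+i_k$ and depth $k$, and let $$E(2n,k)=\sum_{\substack{i_1,\dots,i_k\ \text{positive even}\\ i_1+\dots+i_k=2n}}\zeta(i_1,\dots,i_k).$$ Let $B_m$ denote the $m$-th Bernoulli number. Then for all integers $1\le k\le n$ every series $\zeta(i_1,\dots,i_k)$ occurring in $E(2n,k)$ converges, and $$E(2n,k)=\frac{(-1)^{n-k-1}\pi^{2n}}{(2n+1)!}\sum_{i=0}^{n-k}\binom{n-i}{k}\binom{2n+1}{2i}\,2\,(2^{2i-1}-1)\,B_{2i}.$$ -/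

import Mathlib

/-- The set of summation indices `n₁ > ⋯ > n_k ≥ 1`. -/
abbrev MZVIndex (k : ℕ) : Type :=
  {m : Fin k → ℕ // StrictAnti m ∧ ∀ j, 1 ≤ m j}

/-- The term `1 / (n₁ ^ i₁ ⋯ n_k ^ i_k)`. -/
noncomputable def mzvTerm {k : ℕ} (i : Fin k → ℕ) (m : MZVIndex k) : ℝ :=
  1 / ∏ j, (m.1 j : ℝ) ^ i j

/-- The multiple zeta value `ζ(i₁, …, i_k)`. -/
noncomputable def multiZeta {k : ℕ} (i : Fin k → ℕ) : ℝ :=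
  ∑' m : MZVIndex k, mzvTerm i m

/-- The `k`-tuples of positive even integers with sum `w`. -/
def evenCompositions (w k : ℕ) : Finset (Fin k → ℕ) :=
  (Finset.Nat.antidiagonalTuple k w).filter fun i => ∀ j, 0 < i j ∧ Even (i j)

/-- `E(w, k)`: the sum of all multiple zeta values of weight `w` and depth `k`
whose arguments are (positive) even integers. -/
noncomputable def evenMZVSum (w k : ℕ) : ℝ :=
  ∑ i ∈ evenCompositions w k, multiZeta i

/-!
Encode the sums `E(2n, k)` in the series `F(t) = ∑ E(2n, k) X ^ n t ^ k`. Expanding the product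
over the possible values `m` of the indices, `F(t) = ∏ₘ (1 + t ∑_{c ≥ 1} X ^ c / m ^ (2c))`, and
summing the geometric series turns every factor into
`(1 - (1 - t) X / m²) / (1 - X / m²)`. By Euler's product for the sine,
`∏ₘ (1 - z / m²) = sin (π √z) / (π √z)`, so `F(t)` is
`(π √X / sin (π √X)) * (sin (π √((1 - t) X)) / (π √((1 - t) X)))`. The coefficients of
`√X / sinh √X` are given by Bernoulli numbers, and expanding the powers of `1 - t` that occur in
the second quotient produces the binomial coefficients `(n - i).choose k`.
-/

open Filter Finset Topology PowerSeries
open scoped PowerSeries.WithPiTopology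

section FormalProduct

variable {ι R : Type*}

theorem X_pow_card_dvd_prod [CommSemiring R] {f : ι → R⟦X⟧}
    (hf : ∀ i, constantCoeff (f i) = 0) (s : Finset ι) : X ^ #s ∣ ∏ i ∈ s, f i := by
  rw [← prod_const]
  exact prod_dvd_prod_of_dvd _ _ fun i _ => X_dvd_iff.2 (hf i)

theorem coeff_prod_C_mul [CommSemiring R] {f : ι → R⟦X⟧}
    (hf : ∀ i, constantCoeff (f i) = 0) (t : R) (n : ℕ) (s : Finset ι) :
    coeff n (∏ i ∈ s, C t * f i) =
      ∑ k ∈ range (n + 1), (Set.powersetCard ι k).indicator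
        (fun s => t ^ k * coeff n (∏ i ∈ s, f i)) s := by
  classical
  have hcoeff : n < #s → coeff n (∏ i ∈ s, f i) = 0 :=
    X_pow_dvd_iff.1 (X_pow_card_dvd_prod hf s) n
  simp only [Set.indicator_apply, Set.powersetCard.mem_iff, sum_ite_eq, mem_range,
    prod_mul_distrib, prod_const, ← map_pow, coeff_C_mul]
  split_ifs with h
  · rfl
  · rw [hcoeff (by omega), mul_zero]

theorem hasProd_one_add_C_mul [CommSemiring R] [TopologicalSpace R] [IsTopologicalSemiring R]
    {f : ι → R⟦X⟧} {e : ℕ → R⟦X⟧} (hf : ∀ i, constantCoeff (f i) = 0)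
    (he : ∀ k, HasSum (fun s : Set.powersetCard ι k => ∏ i ∈ s.1, f i) (e k)) (t : R) :
    HasProd (fun i => 1 + C t * f i)
      (.mk fun n => ∑ k ∈ range (n + 1), t ^ k * coeff n (e k)) := by
  refine hasProd_one_add_of_hasSum_prod ((WithPiTopology.hasSum_iff_hasSum_coeff R).2 fun n => ?_)
  simp only [coeff_prod_C_mul hf, coeff_mk]
  refine hasSum_sum fun k _ => hasSum_subtype_iff_indicator.1 ?_
  exact ((WithPiTopology.hasSum_iff_hasSum_coeff R).1 (he k) n).mul_left _

end FormalProduct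

section Esymm

variable {ι R : Type*}

/-- The `k`-th elementary symmetric function of a family `y`, as an infinite sum. -/
noncomputable def tsumEsymm [CommSemiring R] [TopologicalSpace R] (y : ι → R) (k : ℕ) : R :=
  ∑' s : Set.powersetCard ι k, ∏ i ∈ s.1, y i

variable [NormedCommRing R] [NormOneClass R] [CompleteSpace R] {y : ι → R}

theorem hasProd_one_add_C_mul_X (hy : Summable (‖y ·‖)) (t : R) :
    HasProd (fun i => 1 + C (t * y i) * X) (.mk fun n => t ^ n * tsumEsymm y n) := by
  have he (k : ℕ) : HasSum (fun s : Set.powersetCard ι k => ∏ i ∈ s.1, C (y i) * X)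
      (C (tsumEsymm y k) * X ^ k) := by
    have hsum := ((summable_finsetProd_of_summable_norm hy).subtype
      (Set.powersetCard ι k)).hasSum
    simp only [prod_mul_distrib, prod_const, Set.powersetCard.card_eq, ← map_prod]
    exact (hsum.map (C (R := R)) WithPiTopology.continuous_C).mul_right _
  have h := hasProd_one_add_C_mul (f := fun i => C (y i) * X) (by simp) he t
  simpa [coeff_X_pow, ← mul_assoc, ← map_mul] using h

theorem hasSum_pow_mul_tsumEsymm (hy : Summable (‖y ·‖)) (z : R) :
    HasSum (fun n => z ^ n * tsumEsymm y n) (∏' i, (1 + z * y i)) := by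
  have hzy : Summable fun s : Finset ι => ∏ i ∈ s, z * y i :=
    summable_finsetProd_of_summable_norm <|
      (hy.mul_left ‖z‖).of_nonneg_of_le (fun _ => norm_nonneg _) fun _ => norm_mul_le _ _
  have hsigma := (Set.powersetCard.prodEquiv.hasSum_iff.2 hzy.hasSum).sigma fun k =>
    (hzy.subtype (Set.powersetCard ι k)).hasSum
  rw [tprod_one_add hzy]
  convert hsigma using 2 with k
  simp only [Function.comp_apply, prod_mul_distrib, prod_const, Set.powersetCard.card_eq]
  exact (((summable_finsetProd_of_summable_norm hy).subtype
    (Set.powersetCard ι k)).tsum_mul_left _).symm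

end Esymm

theorem eq_zero_of_frequently_hasSum_pow_smul_zero {𝕜 E : Type*} [NontriviallyNormedField 𝕜]
    [NormedAddCommGroup E] [NormedSpace 𝕜 E] [CompleteSpace E] {a : ℕ → E}
    (ha : ∃ᶠ z in 𝓝[≠] (0 : 𝕜), HasSum (fun n => z ^ n • a n) 0) : a = 0 := by
  let p : FormalMultilinearSeries 𝕜 𝕜 E := fun n => .mkPiRing 𝕜 (Fin n) (a n)
  have hcoeff (n : ℕ) : p.coeff n = a n := by simp [p, FormalMultilinearSeries.coeff]
  have hradius : 0 < p.radius := by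
    obtain ⟨z, hz, hz0⟩ := (ha.and_eventually self_mem_nhdsWithin).exists
    refine (ENNReal.coe_pos.2 (nnnorm_pos.2 hz0)).trans_le (p.le_radius_of_tendsto (l := 0) ?_)
    simpa [p, norm_smul, mul_comm] using hz.summable.tendsto_atTop_zero.norm
  have hp : HasFPowerSeriesAt p.sum p 0 := (p.hasFPowerSeriesOnBall hradius).hasFPowerSeriesAt
  have hp0 : p = 0 := by
    by_contra hp0
    have hsum := (hasFPowerSeriesAt_iff.1 hp).filter_mono (nhdsWithin_le_nhds (s := {0}ᶜ))
    obtain ⟨z, hz, hz0, hzsum⟩ := (ha.and_eventually ((hp.locally_ne_zero hp0).and hsum)).exists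
    simp only [hcoeff, zero_add] at hzsum
    exact hz0 (hzsum.unique hz)
  funext n
  rw [← hcoeff, hp0]
  rfl

theorem eq_sum_choose_mul_of_sum_pow_mul_eq {ι R : Type*} [CommRing R] [IsDomain R] [Infinite R]
    {n : ℕ} {a : ℕ → R} {s : Finset ι} {d : ι → ℕ} {b : ι → R} {c : R}
    (h : ∀ t, ∑ k ∈ range (n + 1), t ^ k * a k = ∑ i ∈ s, (t + c) ^ d i * b i)
    {k : ℕ} (hk : k ≤ n) : a k = ∑ i ∈ s, c ^ (d i - k) * (d i).choose k * b i := by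
  have hpoly : ∑ k ∈ range (n + 1), Polynomial.X ^ k * Polynomial.C (a k) =
      ∑ i ∈ s, (Polynomial.X + Polynomial.C c) ^ d i * Polynomial.C (b i) :=
    Polynomial.funext fun t => by
      simpa only [Polynomial.eval_finsetSum, Polynomial.eval_mul, Polynomial.eval_pow,
        Polynomial.eval_add, Polynomial.eval_X, Polynomial.eval_C] using h t
  simpa [Polynomial.finsetSum_coeff, Polynomial.coeff_X_pow, Polynomial.coeff_X_add_C_pow, hk,
    Nat.lt_succ_iff] using congr_arg (Polynomial.coeff · k) hpoly

section Euler

/-- The factor at `m = 0` is `1`, because of the convention `x / 0 = 0`. -/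
theorem hasProd_one_sub_sq_div_sq (x : ℝ) :
    HasProd (fun m : ℕ => 1 - x ^ 2 / (m : ℝ) ^ 2) (Real.sinc (Real.pi * x)) := by
  rcases eq_or_ne x 0 with rfl | hx
  · simp
  have hmul : Multipliable fun m : ℕ => 1 - x ^ 2 / (m : ℝ) ^ 2 := by
    simpa [sub_eq_add_neg] using multipliable_one_add_of_summable (R := ℝ)
      (f := fun m : ℕ => -(x ^ 2 / (m : ℝ) ^ 2)) (by
        simpa [div_eq_mul_inv] using Real.summable_nat_pow_inv.2 one_lt_two |>.mul_left (x ^ 2))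
  have hpi : Real.pi * x ≠ 0 := mul_ne_zero Real.pi_ne_zero hx
  have hsin := ((Real.tendsto_euler_sin_prod x).div_const (Real.pi * x)).congr fun N =>
    mul_div_cancel_left₀ _ hpi
  have hprod : Tendsto (fun N : ℕ => ∏ j ∈ range N, (1 - x ^ 2 / ((j : ℝ) + 1) ^ 2)) atTop
      (𝓝 (∏' m : ℕ, (1 - x ^ 2 / (m : ℝ) ^ 2))) := by
    simpa [Function.comp_def, prod_range_succ'] using
      hmul.hasProd.tendsto_prod_nat.comp (tendsto_add_atTop_nat 1)
  rw [Real.sinc_of_ne_zero hpi, ← tendsto_nhds_unique hprod hsin]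
  exact hmul.hasProd

theorem hasSum_sinc (x : ℝ) :
    HasSum (fun n : ℕ => (-1) ^ n * x ^ (2 * n) / (2 * n + 1).factorial) (Real.sinc x) := by
  rcases eq_or_ne x 0 with rfl | hx
  · convert hasSum_ite_eq (0 : ℕ) (1 : ℝ) using 2 with n
    · split_ifs with hn <;> simp [hn]
    · simp
  rw [Real.sinc_of_ne_zero hx]
  convert! (Real.hasSum_sin x).div_const x using 2 with n
  rw [pow_succ]
  field_simp

/-- The multiple zeta values `ζ(2, …, 2)`. -/
theorem tsumEsymm_one_div_sq (n : ℕ) :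
    tsumEsymm (fun m : ℕ => 1 / (m : ℝ) ^ 2) n = Real.pi ^ (2 * n) / (2 * n + 1).factorial := by
  have hy : Summable fun m : ℕ => ‖1 / (m : ℝ) ^ 2‖ :=
    (Real.summable_one_div_nat_pow.2 one_lt_two).norm
  suffices hfreq : ∃ᶠ z in 𝓝[<] (0 : ℝ), HasSum (fun n => z ^ n •
      (tsumEsymm (fun m : ℕ => 1 / (m : ℝ) ^ 2) n -
        Real.pi ^ (2 * n) / (2 * n + 1).factorial)) 0 from
    sub_eq_zero.1 <| congr_fun
      (eq_zero_of_frequently_hasSum_pow_smul_zero (hfreq.filter_mono (nhdsLT_le_nhdsNE 0))) n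
  refine Eventually.frequently ?_
  filter_upwards [self_mem_nhdsWithin] with z hz
  obtain ⟨x, rfl⟩ : ∃ x, z = -x ^ 2 :=
    ⟨√(-z), by rw [Real.sq_sqrt (neg_nonneg.2 (le_of_lt hz)), neg_neg]⟩
  have hprod : ∏' m : ℕ, (1 + -x ^ 2 * (1 / (m : ℝ) ^ 2)) = Real.sinc (Real.pi * x) := by
    rw [← (hasProd_one_sub_sq_div_sq x).tprod_eq]
    exact tprod_congr fun m => by ring
  convert! (hasSum_pow_mul_tsumEsymm hy (-x ^ 2)).sub (hasSum_sinc (Real.pi * x)) using 2 with m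
  · rw [smul_eq_mul, neg_pow, ← pow_mul]
    ring
  · rw [hprod, sub_self]

end Euler

section HyperbolicSine

/-- The power series `sinh √X / √X`. -/
noncomputable def sinhcSqrt (K : Type*) [Field K] : K⟦X⟧ :=
  .mk fun n => 1 / ((2 * n + 1).factorial : K)

/-- The power series `√X / sinh √X`, defined by its coefficients in terms of Bernoulli numbers. -/
noncomputable def invSinhcSqrt (K : Type*) [Field K] : K⟦X⟧ :=
  .mk fun n => (2 - 2 ^ (2 * n)) * (bernoulli (2 * n) : K) / ((2 * n).factorial : K)

theorem two_mul_bernoulli_sub_rescale_mul_exp_sub_exp_neg (A : Type*) [CommRing A] [Algebra ℚ A] :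
    (2 * bernoulliPowerSeries A - rescale 2 (bernoulliPowerSeries A)) *
      (exp A - evalNegHom (exp A)) = 2 * X := by
  have hB := bernoulliPowerSeries_mul_exp_sub_one A
  have hB₂ : rescale 2 (bernoulliPowerSeries A) * (exp A ^ 2 - 1) = 2 * X := by
    have hexp := exp_pow_eq_rescale_exp (A := A) 2
    rw [Nat.cast_ofNat] at hexp
    simpa [rescale_X, ← hexp, map_ofNat (C (R := A))] using congr_arg (rescale 2) hB
  have hE := exp_mul_exp_neg_eq_one (A := A)
  set E := exp A
  set F := evalNegHom E
  set B := bernoulliPowerSeries A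
  set B₂ := rescale 2 B
  linear_combination (2 * (1 + E) * F) * hB - F * hB₂ + (2 * X - (2 * B - B₂) * E) * hE

variable (K : Type*) [Field K] [CharZero K]

theorem exp_sub_exp_neg_eq_two_mul_X_mul_expand :
    exp K - evalNegHom (exp K) = 2 * X * expand 2 two_ne_zero (sinhcSqrt K) := by
  ext m
  rw [mul_assoc, ← map_ofNat (C (R := K)), coeff_C_mul, map_sub, evalNegHom, coeff_rescale]
  obtain ⟨n, rfl | rfl⟩ := m.even_or_odd'
  · rcases n with _ | n
    · simp
    · rw [Nat.mul_succ, coeff_succ_X_mul, coeff_expand_of_not_dvd _ _ _ (by omega)]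
      simp [pow_add, pow_mul]
  · rw [coeff_succ_X_mul, coeff_expand_mul, coeff_exp, sinhcSqrt, coeff_mk, pow_succ, pow_mul]
    simp
    ring

theorem two_mul_bernoulli_sub_rescale_eq_expand :
    2 * bernoulliPowerSeries K - rescale 2 (bernoulliPowerSeries K) =
      expand 2 two_ne_zero (invSinhcSqrt K) := by
  ext m
  rw [← map_ofNat (C (R := K)), map_sub, coeff_C_mul, coeff_rescale, ← sub_mul,
    bernoulliPowerSeries, coeff_mk]
  obtain ⟨n, rfl | rfl⟩ := m.even_or_odd'
  · rw [coeff_expand_mul, invSinhcSqrt, coeff_mk]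
    simp [mul_div_assoc]
  · rw [coeff_expand_of_not_dvd _ _ _ (by omega)]
    rcases n with _ | n
    · simp
    · simp [bernoulli_eq_zero_of_odd (odd_two_mul_add_one _)]

theorem invSinhcSqrt_mul_sinhcSqrt : invSinhcSqrt K * sinhcSqrt K = 1 := by
  have h := two_mul_bernoulli_sub_rescale_mul_exp_sub_exp_neg K
  have htwo : (2 : K⟦X⟧) ≠ 0 := by
    rw [← map_ofNat (C (R := K))]
    exact (map_ne_zero_iff C C_injective).2 two_ne_zero
  rw [two_mul_bernoulli_sub_rescale_eq_expand, exp_sub_exp_neg_eq_two_mul_X_mul_expand,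
    mul_left_comm, ← map_mul, mul_eq_left₀ (mul_ne_zero htwo X_ne_zero),
    ← map_one (expand 2 two_ne_zero)] at h
  ext n
  rw [← coeff_expand_mul 2 two_ne_zero, h, coeff_expand_mul]

end HyperbolicSine

section EvenMZV

theorem coeff_prod_univ_fin {R : Type*} [CommSemiring R] {k : ℕ} (f : Fin k → R⟦X⟧) (w : ℕ) :
    coeff w (∏ j, f j) = ∑ i ∈ Nat.antidiagonalTuple k w, ∏ j, coeff (i j) (f j) := by
  rw [coeff_prod, ← piAntidiag_univ_fin_eq_antidiagonalTuple, finsuppAntidiag, sum_map,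
    ← sum_attach (piAntidiag univ w)]
  rfl

/-- The power series `∑_{c ≥ 1} y ^ c * X ^ c`; for `y = 1 / m ^ 2` it collects the possible
contributions of an index `m` to a term of `E(2n, k)`. -/
noncomputable def posGeomSeries {R : Type*} [Semiring R] (y : R) : R⟦X⟧ :=
  .mk fun c => if 0 < c then y ^ c else 0

theorem one_sub_C_mul_X_mul_posGeomSeries {R : Type*} [CommRing R] (y : R) :
    (1 - C y * X) * posGeomSeries y = C y * X := by
  ext c
  rw [sub_mul, one_mul, mul_assoc, map_sub, coeff_C_mul, coeff_C_mul, posGeomSeries]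
  rcases c with _ | _ | c
  · simp
  · simp [coeff_succ_X_mul]
  · simp [coeff_succ_X_mul, coeff_X, pow_succ']

/-- The set of the entries `n₁, …, n_k` of an index of summation. -/
def MZVIndex.toPowersetCard {k : ℕ} (m : MZVIndex k) : Set.powersetCard ℕ k :=
  Set.powersetCard.ofFinEmb k ℕ ⟨m.1, m.2.1.injective⟩

theorem MZVIndex.toPowersetCard_injective (k : ℕ) :
    Function.Injective (toPowersetCard (k := k)) := fun m m' h => by
  have hrange : Set.range m.1 = Set.range m'.1 := by
    simpa [toPowersetCard] using congr_arg (SetLike.coe (B := ℕ)) h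
  exact Subtype.ext (m.2.1.range_inj m'.2.1 |>.1 hrange)

theorem MZVIndex.mem_range_toPowersetCard {k : ℕ} {T : Set.powersetCard ℕ k} (hT : 0 ∉ T) :
    T ∈ Set.range (toPowersetCard (k := k)) := by
  let f := Set.powersetCard.ofFinEmbEquiv.symm T
  have hf (j : Fin k) : f j ∈ T :=
    (Set.powersetCard.mem_range_ofFinEmbEquiv_symm_iff_mem T _).1 (Set.mem_range_self j)
  refine ⟨⟨f ∘ Fin.rev, f.strictMono.comp_strictAnti Fin.rev_strictAnti, fun j =>
    Nat.one_le_iff_ne_zero.2 (ne_of_mem_of_not_mem (hf _) hT)⟩, SetLike.ext fun a => ?_⟩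
  rw [← Set.powersetCard.mem_range_ofFinEmbEquiv_symm_iff_mem T, toPowersetCard,
    Set.powersetCard.mem_ofFinEmb_iff_mem_range]
  exact Set.ext_iff.1 (Fin.rev_surjective.range_comp f) a

theorem MZVIndex.prod_toPowersetCard {M : Type*} [CommMonoid M] {k : ℕ} (m : MZVIndex k)
    (f : ℕ → M) : ∏ a ∈ m.toPowersetCard.1, f a = ∏ j, f (m.1 j) := by
  simp [toPowersetCard]

theorem summable_mzvTerm {k : ℕ} {i : Fin k → ℕ} (hi : ∀ j, 2 ≤ i j) :
    Summable (mzvTerm i) := by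
  have hsq : Summable fun m : MZVIndex k => ∏ a ∈ m.toPowersetCard.1, 1 / (a : ℝ) ^ 2 :=
    (summable_finsetProd_of_summable_nonneg (fun a : ℕ => by positivity)
      (Real.summable_one_div_nat_pow.2 one_lt_two)).comp_injective
      (Subtype.val_injective.comp (MZVIndex.toPowersetCard_injective k))
  refine hsq.of_nonneg_of_le (fun m => by unfold mzvTerm; positivity) fun m => ?_
  simp only [m.prod_toPowersetCard, mzvTerm, one_div, ← prod_inv_distrib]
  refine prod_le_prod (fun j _ => by positivity) fun j _ => ?_
  have hm : (1 : ℝ) ≤ m.1 j := by exact_mod_cast m.2.2 j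
  exact inv_anti₀ (by positivity) (pow_le_pow_right₀ hm (hi j))

theorem two_le_of_mem_evenCompositions {w k : ℕ} {i : Fin k → ℕ}
    (hi : i ∈ evenCompositions w k) (j : Fin k) : 2 ≤ i j := by
  obtain ⟨hpos, heven⟩ := (mem_filter.1 hi).2 j
  exact Nat.le_of_dvd hpos heven.two_dvd

theorem sum_evenCompositions_mzvTerm (n : ℕ) {k : ℕ} (m : MZVIndex k) :
    ∑ i ∈ evenCompositions (2 * n) k, mzvTerm i m =
      coeff n (∏ j, posGeomSeries (1 / (m.1 j : ℝ) ^ 2)) := by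
  have hcoeff (y : ℝ) (c : ℕ) : coeff c (expand 2 two_ne_zero (posGeomSeries (1 / y ^ 2))) =
      if 0 < c ∧ Even c then 1 / y ^ c else 0 := by
    obtain ⟨b, rfl | rfl⟩ := c.even_or_odd'
    · simp [coeff_expand_mul, posGeomSeries, pow_mul]
    · rw [coeff_expand_of_not_dvd _ _ _ (by omega), if_neg (by simp)]
  rw [← coeff_expand_mul 2 two_ne_zero, map_prod, coeff_prod_univ_fin, evenCompositions,
    sum_filter]
  simp only [hcoeff, prod_ite_zero, mem_univ, forall_const]
  simp only [mzvTerm, one_div, prod_inv_distrib]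

theorem hasSum_prod_posGeomSeries (k : ℕ) :
    HasSum (fun T : Set.powersetCard ℕ k => ∏ m ∈ T.1, posGeomSeries (1 / (m : ℝ) ^ 2))
      (.mk fun n => evenMZVSum (2 * n) k) := by
  rw [WithPiTopology.hasSum_iff_hasSum_coeff]
  intro n
  refine ((MZVIndex.toPowersetCard_injective k).hasSum_iff fun T hT => ?_).1 ?_
  · have h0 : 0 ∈ T.1 := by_contra fun h0 => hT (MZVIndex.mem_range_toPowersetCard h0)
    rw [prod_eq_zero h0, map_zero]
    ext c
    simp +contextual [posGeomSeries, Nat.pos_iff_ne_zero]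
  · simp only [Function.comp_def, MZVIndex.prod_toPowersetCard, coeff_mk,
      ← sum_evenCompositions_mzvTerm]
    exact hasSum_sum fun i hi => (summable_mzvTerm (two_le_of_mem_evenCompositions hi)).hasSum

end EvenMZV

section GeneratingFunction

theorem hasProd_sinhcSqrt (u : ℝ) :
    HasProd (fun m : ℕ => 1 + C (u * (1 / (m : ℝ) ^ 2)) * X)
      (rescale (u * Real.pi ^ 2) (sinhcSqrt ℝ)) := by
  convert! hasProd_one_add_C_mul_X (Real.summable_one_div_nat_pow.2 one_lt_two).norm u using 1
  ext n
  rw [coeff_rescale, sinhcSqrt, coeff_mk, coeff_mk, tsumEsymm_one_div_sq]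
  ring

/-- The generating series `∑_{n, k} E(2n, k) X ^ n t ^ k`; the inner sum stops at `k = n` because
`E(2n, k)` is an empty sum for `k > n`. -/
noncomputable def evenMZVGen (t : ℝ) : ℝ⟦X⟧ :=
  .mk fun n => ∑ k ∈ range (n + 1), t ^ k * evenMZVSum (2 * n) k

theorem hasProd_evenMZVGen (t : ℝ) :
    HasProd (fun m : ℕ => 1 + C t * posGeomSeries (1 / (m : ℝ) ^ 2)) (evenMZVGen t) := by
  have hprod := hasProd_one_add_C_mul
    (fun m : ℕ => by simp [posGeomSeries]) hasSum_prod_posGeomSeries t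
  simp only [coeff_mk] at hprod
  exact hprod

theorem evenMZVGen_eq (t : ℝ) :
    evenMZVGen t = rescale (-Real.pi ^ 2) (invSinhcSqrt ℝ) *
      rescale ((t - 1) * Real.pi ^ 2) (sinhcSqrt ℝ) := by
  have hfactor (y : ℝ) : (1 + C (-1 * y) * X) * (1 + C t * posGeomSeries y) =
      1 + C ((t - 1) * y) * X := by
    simp only [map_mul, map_sub, map_neg, map_one]
    linear_combination C t * one_sub_C_mul_X_mul_posGeomSeries y
  have hprod := (hasProd_sinhcSqrt (-1)).mul (hasProd_evenMZVGen t)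
  simp only [hfactor] at hprod
  rw [← hprod.unique (hasProd_sinhcSqrt (t - 1)), ← mul_assoc, neg_one_mul, ← map_mul,
    invSinhcSqrt_mul_sinhcSqrt, map_one, one_mul]

theorem evenMZVSum_eq_sum_coeff {n k : ℕ} (hkn : k ≤ n) :
    evenMZVSum (2 * n) k = (-1) ^ (n - k) * Real.pi ^ (2 * n) * ∑ i ∈ range (n - k + 1),
      (n - i).choose k * (coeff i (invSinhcSqrt ℝ) * coeff (n - i) (sinhcSqrt ℝ)) := by
  have hgen (t : ℝ) : ∑ k ∈ range (n + 1), t ^ k * evenMZVSum (2 * n) k =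
      ∑ i ∈ range (n + 1), (t + -1) ^ (n - i) * ((-1) ^ i * Real.pi ^ (2 * n) *
        (coeff i (invSinhcSqrt ℝ) * coeff (n - i) (sinhcSqrt ℝ))) := by
    have h := congr_arg (coeff n) (evenMZVGen_eq t)
    rw [evenMZVGen, coeff_mk, coeff_mul, Nat.sum_antidiagonal_eq_sum_range_succ_mk] at h
    refine h.trans (sum_congr rfl fun i hi => ?_)
    have hpi : Real.pi ^ (2 * n) = (Real.pi ^ 2) ^ i * (Real.pi ^ 2) ^ (n - i) := by
      rw [← pow_add, Nat.add_sub_of_le (mem_range_succ_iff.1 hi), pow_mul]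
    rw [coeff_rescale, coeff_rescale, hpi, neg_pow, mul_pow]
    ring
  rw [eq_sum_choose_mul_of_sum_pow_mul_eq hgen hkn, mul_sum]
  refine (sum_subset (range_subset_range.2 (by omega)) fun i hin hi => ?_).symm.trans
    (sum_congr rfl fun i hi => ?_)
  · rw [mem_range] at hin hi
    simp [Nat.choose_eq_zero_of_lt (show n - i < k by omega)]
  · have hsign : (-1 : ℝ) ^ (n - k) = (-1) ^ (n - i - k) * (-1) ^ i := by
      rw [← pow_add]
      congr 1
      have := mem_range_succ_iff.1 hi
      omega
    rw [hsign]
    ring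

theorem coeff_invSinhcSqrt_mul_coeff_sinhcSqrt (K : Type*) [Field K] [CharZero K] {n i : ℕ}
    (hi : i ≤ n) : coeff i (invSinhcSqrt K) * coeff (n - i) (sinhcSqrt K) =
      (2 * n + 1).choose (2 * i) * (2 - 2 ^ (2 * i)) * bernoulli (2 * i) /
        (2 * n + 1).factorial := by
  have hfac : ((2 * n + 1).factorial : K) ≠ 0 := mod_cast (2 * n + 1).factorial_ne_zero
  rw [invSinhcSqrt, sinhcSqrt, coeff_mk, coeff_mk, Nat.cast_choose K (by omega),
    show 2 * n + 1 - 2 * i = 2 * (n - i) + 1 by omega]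
  field_simp

theorem neg_one_zpow_sub_sub_one {K : Type*} [DivisionRing K] {n k : ℕ} (hkn : k ≤ n) :
    (-1 : K) ^ ((n : ℤ) - k - 1) = -(-1) ^ (n - k) := by
  rw [zpow_sub_one₀ (by simp), ← Nat.cast_sub hkn, zpow_natCast, inv_neg_one, mul_neg_one]

theorem two_mul_two_zpow_sub_one {K : Type*} [Field K] [NeZero (2 : K)] (i : ℕ) :
    2 * ((2 : K) ^ (2 * (i : ℤ) - 1) - 1) = 2 ^ (2 * i) - 2 := by
  have h : (2 : K) ^ (2 * (i : ℤ) - 1) * 2 = 2 ^ (2 * i) := by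
    rw [← zpow_add_one₀ two_ne_zero, sub_add_cancel, ← zpow_natCast, Nat.cast_mul, Nat.cast_ofNat]
  linear_combination h

end GeneratingFunction

theorem theorem3 (n k : ℕ) (hk : 1 ≤ k) (hkn : k ≤ n) :
    (∀ i ∈ evenCompositions (2 * n) k, Summable (mzvTerm i)) ∧
    evenMZVSum (2 * n) k =
      (-1 : ℝ) ^ ((n : ℤ) - (k : ℤ) - 1) * Real.pi ^ (2 * n) / ((2 * n + 1).factorial : ℝ) *
        ∑ i ∈ Finset.range (n - k + 1),
          ((n - i).choose k : ℝ) * ((2 * n + 1).choose (2 * i) : ℝ) *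
            (2 * ((2 : ℝ) ^ (2 * (i : ℤ) - 1) - 1)) * ((bernoulli (2 * i) : ℚ) : ℝ) := by
  refine ⟨fun i hi => summable_mzvTerm (two_le_of_mem_evenCompositions hi), ?_⟩
  rw [evenMZVSum_eq_sum_coeff hkn, neg_one_zpow_sub_sub_one hkn, mul_sum, mul_sum]
  refine sum_congr rfl fun i hi => ?_
  have hin : i ≤ n := (mem_range_succ_iff.1 hi).trans (Nat.sub_le n k)
  rw [coeff_invSinhcSqrt_mul_coeff_sinhcSqrt ℝ hin, two_mul_two_zpow_sub_one]
  ring
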